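/- **Curves.** A base $X^\theta$ is one of nine patterns $X\in\{I,R,L,U,B,D,P,Q,C\}$ with a counterclockwise rotation $\theta\in\{0,90,180,270\}$ (degrees); it stands for a point with an entry and an exit direction. Unrotated, $I,R,L,U$ are entered moving upwards (bottom-in) and left to the top, right, left, bottom, respectively; $B,D$ have no entry direction and are left to the top; $P,Q$ are entered from the bottom and have no exit direction; $C$ has neither. A base has two level-1 expansions $X_1$, $X_2$ (codes 1, 2) into four bases: $$\begin{aligned} I_1&=R\,L^{270}L\,R^{90}, & R_1&=I\,R\,R^{270}L^{180}, & L_1&=R\,L^{270}L\,I^{90},\\ U_1&=I\,R\,R^{270}I^{180}, & B_1&=L^{180}L^{270}L\,R^{90}, & D_1&=R^{270}R^{180}R^{90}I,\\ P_1&=R\,L^{270}L\,L^{90}, & Q_1&=I\,R\,R^{270}R^{180}, & C_1&=R^{90}R\,R^{270}R^{180}; \end{aligned}$$ $X_2$ is obtained from $X_1$ (from $L_1$, $R_1$ if $X=R$, $L$, respectively) by exchanging $R$ and $L$ and replacing each rotation $\theta$ by $-\theta$. The expansion of $X^\theta$ with code $\pi$ is $X_\pi$ with $\theta$ added to all rotations.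 A sequence of bases is expanded by choosing the code of its first base; each further base gets the code of its predecessor if their rotations agree modulo $180$, and the other code if not. For $\pi_1,\dots,\pi_k\in\{1,2\}$, the level-$k$ curve $\mathcal P_k=X^\theta|\pi_1\cdots\pi_k$ is the sequence of $4^k$ bases obtained from the single base $X^\theta$ by $k$ such expansions, the $i$-th with first code $\pi_i$. Its reduction by depth $d$ is $\mathrm{Rd}_d(\mathcal P_k)=\mathcal P_{k-d}=X^\theta|\pi_1\cdots\pi_{k-d}$. Its subunits $\mathcal U_1,\dots,\mathcal U_4$ (on level $k-1$) are the four consecutive blocks of $4^{k-1}$ bases, and its lowest level-2 units are the $4^{k-2}$ consecutive blocks of $16$ bases. **Shapes.** A sequence of bases draws a lattice path, going from each point to the next one in its exit direction. Two sequences have the same shape if, ignoring the entry and exit directions of the whole sequences, their paths can be made to overlap completely by rotation, reflection, reversal (and translation). **Definitions.** $\mathcal P_k$ is *recursive* if for all $3\le i\le k$ the four subunits of $\mathcal P_i=\mathrm{Rd}_{k-i}(\mathcal P_k)$ and its depth-1 reduction $\mathcal P_{i-1}$ all have the same shape. $\mathcal P_k$ ($k\ge2$) is a *Hilbert curve* if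 for all $2\le i\le k$ all lowest level-2 units of $\mathcal P_i$ are Hilbert units, that is, have the shape of $I|11$. **Proposition.** Every Hilbert curve, on any level $k\ge 2$, is recursive. A curve on a level $k\ge3$ is recursive if and only if it is a Hilbert curve or a level-3 curve $X^\theta|121$ or $X^\theta|212$ with $X\in\{B,P\}$ (and any rotation $\theta$). -/

import Mathlib

namespace TwoByTwo

/-- The nine base patterns. In base rotation state: `I` bottom-in and top-out, `R` bottom-in and
right-out, `L` bottom-in and left-out, `U` bottom-in and bottom-out, `B` and `D` entry-closed and
top-out, `P` and `Q` bottom-in and exit-closed, `C` entry-closed and exit-closed. -/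
inductive BasePattern
  | I | R | L | U | B | D | P | Q | C
  deriving DecidableEq

/-- A base pattern together with a counterclockwise rotation, counted in quarter turns. -/
structure Base where
  pattern : BasePattern
  rot : ZMod 4
  deriving DecidableEq

/-- The expansion codes 1 and 2. -/
inductive Code
  | one | two
  deriving DecidableEq

/-- The complementary code. -/
def Code.compl : Code → Code
  | .one => .two
  | .two => .one

/-- The two level-1 expansions of each base pattern in its base rotation state: the 2x2 units
with the entry and exit directions of the pattern, whose entry point is the lower left corner for
code 1 and the lower right corner for code 2 (for `D`: the upper right and the upper left corner).
Code 2 is always the mirror image of the code 1 expansion of the mirrored pattern. -/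
def levelOne : BasePattern → Code → List Base
  | .I, .one => [⟨.R, 0⟩, ⟨.L, 3⟩, ⟨.L, 0⟩, ⟨.R, 1⟩]
  | .I, .two => [⟨.L, 0⟩, ⟨.R, 1⟩, ⟨.R, 0⟩, ⟨.L, 3⟩]
  | .R, .one => [⟨.I, 0⟩, ⟨.R, 0⟩, ⟨.R, 3⟩, ⟨.L, 2⟩]
  | .R, .two => [⟨.L, 0⟩, ⟨.R, 1⟩, ⟨.R, 0⟩, ⟨.I, 3⟩]
  | .L, .one => [⟨.R, 0⟩, ⟨.L, 3⟩, ⟨.L, 0⟩, ⟨.I, 1⟩]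
  | .L, .two => [⟨.I, 0⟩, ⟨.L, 0⟩, ⟨.L, 1⟩, ⟨.R, 2⟩]
  | .U, .one => [⟨.I, 0⟩, ⟨.R, 0⟩, ⟨.R, 3⟩, ⟨.I, 2⟩]
  | .U, .two => [⟨.I, 0⟩, ⟨.L, 0⟩, ⟨.L, 1⟩, ⟨.I, 2⟩]
  | .B, .one => [⟨.L, 2⟩, ⟨.L, 3⟩, ⟨.L, 0⟩, ⟨.R, 1⟩]
  | .B, .two => [⟨.R, 2⟩, ⟨.R, 1⟩, ⟨.R, 0⟩, ⟨.L, 3⟩]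
  | .D, .one => [⟨.R, 3⟩, ⟨.R, 2⟩, ⟨.R, 1⟩, ⟨.I, 0⟩]
  | .D, .two => [⟨.L, 1⟩, ⟨.L, 2⟩, ⟨.L, 3⟩, ⟨.I, 0⟩]
  | .P, .one => [⟨.R, 0⟩, ⟨.L, 3⟩, ⟨.L, 0⟩, ⟨.L, 1⟩]
  | .P, .two => [⟨.L, 0⟩, ⟨.R, 1⟩, ⟨.R, 0⟩, ⟨.R, 3⟩]
  | .Q, .one => [⟨.I, 0⟩, ⟨.R, 0⟩, ⟨.R, 3⟩, ⟨.R, 2⟩]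
  | .Q, .two => [⟨.I, 0⟩, ⟨.L, 0⟩, ⟨.L, 1⟩, ⟨.L, 2⟩]
  | .C, .one => [⟨.R, 1⟩, ⟨.R, 0⟩, ⟨.R, 3⟩, ⟨.R, 2⟩]
  | .C, .two => [⟨.L, 3⟩, ⟨.L, 0⟩, ⟨.L, 1⟩, ⟨.L, 2⟩]

/-- The level-1 expansion of a rotated base: expand the pattern, then rotate the unit. -/
def Base.expand (b : Base) (c : Code) : List Base :=
  (levelOne b.pattern c).map fun z => ⟨z.pattern, z.rot + b.rot⟩

/-- The code of the next base `b'`, if its predecessor `b` has code `c`: the same code if the two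
rotations agree modulo 180 degrees, and the complement otherwise. -/
def nextCode (c : Code) (b b' : Base) : Code :=
  if b.rot - b'.rot = 0 ∨ b.rot - b'.rot = 2 then c else c.compl

/-- Expansion of a base sequence to the next level, where `c` is the code of its first base. -/
def expandSeq : Code → List Base → List Base
  | _, [] => []
  | c, [b] => b.expand c
  | c, b :: b' :: s => b.expand c ++ expandSeq (nextCode c b b') (b' :: s)

/-- A 2x2 curve initialized from a single base, given by its encoding `X^θ|π₁…πₖ`. -/
structure Curve where
  seed : Base
  code : List Code
  deriving DecidableEq

namespace Curve

/-- The level `k` of `X^θ|π₁…πₖ`. -/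
def level (P : Curve) : ℕ := P.code.length

/-- The sequence of `4 ^ k` bases of the curve. -/
def seq (P : Curve) : List Base := P.code.foldl (fun s c => expandSeq c s) [P.seed]

/-- The reduction `Rd_d` by depth `d`, which undoes the last `d` expansions. -/
def reduce (d : ℕ) (P : Curve) : Curve := ⟨P.seed, P.code.take (P.level - d)⟩

end Curve

/-- Counterclockwise rotation of the grid by 90 degrees. -/
def quarterTurn (p : ℤ × ℤ) : ℤ × ℤ := (-p.2, p.1)

/-- Horizontal reflection of the grid. -/
def hReflect (p : ℤ × ℤ) : ℤ × ℤ := (-p.1, p.2)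

/-- The unit vector obtained from the upward one by `r` counterclockwise quarter turns. -/
def heading (r : ZMod 4) : ℤ × ℤ := quarterTurn^[r.val] (0, 1)

/-- The displacement from the point of a base to the next point, along the exit direction;
exit-closed bases have no exit direction. -/
def Base.step (b : Base) : ℤ × ℤ :=
  match b.pattern with
  | .I | .B | .D => heading b.rot
  | .R => heading (b.rot - 1)
  | .L => heading (b.rot + 1)
  | .U => heading (b.rot + 2)
  | .P | .Q | .C => 0

/-- The points visited by a base sequence whose first point is `p`. The step out of the last base,
that is, its exit direction, plays no role, and neither does the entry direction of the first. -/
def pointsFrom (p : ℤ × ℤ) : List Base → List (ℤ × ℤ)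
  | [] => []
  | b :: s => p :: pointsFrom (p + b.step) s

/-- The lattice path drawn by a base sequence, without its entry and exit directions. -/
def path (s : List Base) : List (ℤ × ℤ) := pointsFrom 0 s

/-- Two base sequences have the same shape: ignoring entry and exit directions, their paths can be
brought to overlap by rotation, reflection and reversal (and a translation, as the position of a
curve in the plane is irrelevant). Each combination of rotations and reflections is a power of the
quarter turn, possibly after the horizontal reflection. -/
def SameShape (s t : List Base) : Prop :=
  ∃ (n : ℕ) (m : Bool) (v : ℤ × ℤ),
    let g : ℤ × ℤ → ℤ × ℤ := fun p => quarterTurn^[n] (if m then hReflect p else p) + v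
    path s = (path t).map g ∨ path s = ((path t).map g).reverse

/-- The block with index `j` (from 0) when a sequence is cut into blocks of length `m`. -/
def block {α : Type*} (m j : ℕ) (s : List α) : List α := (s.drop (j * m)).take m

namespace Curve

/-- The four subunits on level `k - 1` of a level-`k` curve, `k ≥ 1`. -/
def subunit (P : Curve) (j : Fin 4) : List Base := block (4 ^ (P.level - 1)) j P.seq

/-- The lowest level-2 units of a level-`k` curve, `k ≥ 2`. -/
def levelTwoUnit (P : Curve) (j : Fin (4 ^ (P.level - 2))) : List Base := block 16 j P.seq

end Curve

/-- A Hilbert unit is a level-2 unit with the shape of `I|11`. -/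
def IsHilbertUnit (s : List Base) : Prop :=
  SameShape s (Curve.seq ⟨⟨.I, 0⟩, [.one, .one]⟩)

namespace Curve

/-- `P` is a Hilbert curve: its level `k` is at least 2, and for `2 ≤ i ≤ k` all lowest level-2
units of `Rd_{k-i}(P)` are Hilbert units. -/
def IsHilbert (P : Curve) : Prop :=
  2 ≤ P.level ∧ ∀ i, 2 ≤ i → i ≤ P.level →
    ∀ j, IsHilbertUnit ((P.reduce (P.level - i)).levelTwoUnit j)

/-- `P` of level `k` is recursive: for `3 ≤ i ≤ k`, the four subunits of `P_i = Rd_{k-i}(P)` and its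
depth-1 reduction all have the same shape. -/
def IsRecursive (P : Curve) : Prop :=
  ∀ i, 3 ≤ i → i ≤ P.level → ∀ j : Fin 4,
    SameShape ((P.reduce (P.level - i)).subunit j) ((P.reduce (P.level - i)).reduce 1).seq

end Curve

end TwoByTwo

/-!
Expansion is a letterwise substitution in disguise: along a sequence, the code of a base depends
only on the parity of its rotation (`expandSeq_cons`), so each of the two choices of a first code
fixes one of two substitutions `subst c`. For a seed with an entry and an exit direction (pattern
`I`, `R`, `L` or `U`) the first base keeps its rotation, hence a constant code sequence iterates one
and the same substitution (`seq_replicate`). By induction on the level, the steps of such a curve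
are the image of the classical Hilbert word under a symmetry of the grid that can be read off from
the seed (`map_step_gen`). Consequently all curves of a given level of this kind have the same
shape, and as their subunits and level-2 units are again of this kind, they are Hilbert curves and
recursive (`isHilbert_replicate`, `isRecursive_replicate`).

There are no other Hilbert curves: on level 2 the seed and the first two codes are settled by
inspection, and a later change of the code produces a level-2 unit that expands an open base by two
different substitutions, which is never a Hilbert unit (`isHilbert_iff_replicate`).

Conversely, inspection of the curves of level 3 leaves, besides those with an open seed and a
constant code, only the exceptional curves, and inspection of level 4 shows that these do not extend
(`recursive_levelThree`, `not_recursive_levelFour`). If a recursive curve with an open seed starts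
with three equal codes, then a first deviation at a later level is impossible: the first subunit has
the shape of the previous level, so that its first level-2 unit overlaps with a level-2 unit of the
previous level, a Hilbert unit, whereas two different substitutions do not produce one
(`eq_of_sameShape`).

The inspections are kernel evaluations; for this, having the same shape is shown to be decidable.
-/

namespace TwoByTwo

/-! ### Symmetries of the grid -/

/-- The symmetry of the square lattice given by `g = (r, m)`: the horizontal reflection if `m` is
true, followed by `r` quarter turns. -/
def act (g : ZMod 4 × Bool) (p : ℤ × ℤ) : ℤ × ℤ :=
  quarterTurn^[g.1.val] (if g.2 then hReflect p else p)

/-- Composition of symmetries, `act (comp g h) = act g ∘ act h`. -/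
def comp (g h : ZMod 4 × Bool) : ZMod 4 × Bool :=
  (if g.2 then g.1 - h.1 else g.1 + h.1, xor g.2 h.2)

/-- The inverse symmetry; reflections are involutions. -/
def inv (g : ZMod 4 × Bool) : ZMod 4 × Bool := (if g.2 then g.1 else -g.1, g.2)

/-- Symmetries are linear, so that identities between them can be checked on the unit vectors. -/
theorem act_eq (g : ZMod 4 × Bool) (p : ℤ × ℤ) :
    act g p = (p.1 * (act g (1, 0)).1 + p.2 * (act g (0, 1)).1,
      p.1 * (act g (1, 0)).2 + p.2 * (act g (0, 1)).2) := by
  obtain ⟨r, m⟩ := g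
  obtain ⟨x, y⟩ := p
  fin_cases r <;> cases m <;> simp [act, quarterTurn, hReflect, ZMod.val]

theorem act_comp (g h : ZMod 4 × Bool) (p : ℤ × ℤ) : act (comp g h) p = act g (act h p) := by
  have h₁ : ∀ g h : ZMod 4 × Bool, act (comp g h) (1, 0) = act g (act h (1, 0)) := by decide
  have h₂ : ∀ g h : ZMod 4 × Bool, act (comp g h) (0, 1) = act g (act h (0, 1)) := by decide
  rw [act_eq (comp g h) p, h₁, h₂, act_eq g (act h p), act_eq g (act h (1, 0)),
    act_eq g (act h (0, 1)), act_eq h p]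
  ext <;> dsimp only <;> ring

theorem comp_inv_cancel (g h : ZMod 4 × Bool) : comp (comp g (inv h)) h = g := by
  revert g h; decide

theorem act_add (g : ZMod 4 × Bool) (p q : ℤ × ℤ) : act g (p + q) = act g p + act g q := by
  rw [act_eq g (p + q), act_eq g p, act_eq g q]
  ext <;> simp only [Prod.fst_add, Prod.snd_add] <;> ring

theorem act_zero (g : ZMod 4 × Bool) : act g 0 = 0 := by
  revert g; decide

theorem iterate_quarterTurn (n : ℕ) (p : ℤ × ℤ) :
    quarterTurn^[n] p = quarterTurn^[(n : ZMod 4).val] p := by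
  have h4 : quarterTurn^[4] = id := by
    funext ⟨x, y⟩
    simp [quarterTurn]
  rw [ZMod.val_natCast]
  conv_lhs => rw [← Nat.mod_add_div n 4]
  rw [Function.iterate_add_apply, Function.iterate_mul, h4, Function.iterate_id, id]

theorem sameShape_iff {s t : List Base} : SameShape s t ↔ ∃ (g : ZMod 4 × Bool) (v : ℤ × ℤ),
    path s = (path t).map (act g · + v) ∨ path s = ((path t).map (act g · + v)).reverse := by
  constructor
  · rintro ⟨n, m, v, h⟩
    refine ⟨((n : ZMod 4), m), v, ?_⟩
    simpa only [act, ← iterate_quarterTurn] using h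
  · rintro ⟨g, v, h⟩
    exact ⟨g.1.val, g.2, v, h⟩

/-- Having the same shape is decidable: for each of the eight symmetries, with or without reversal,
the translation is determined by the first point. -/
instance : DecidableRel SameShape := fun s t =>
  decidable_of_iff (∃ g : ZMod 4 × Bool,
      path s = ((path t).map (act g)).map
        (· + ((path s).headD 0 - ((path t).map (act g)).headD 0)) ∨
      path s = ((path t).map (act g)).reverse.map
        (· + ((path s).headD 0 - ((path t).map (act g)).reverse.headD 0))) <| by
    -- Comparing first points shows that no other translation is possible.
    have key : ∀ (l q : List (ℤ × ℤ)), l = q.map (· + (l.headD 0 - q.headD 0)) ↔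
        ∃ v, l = q.map (· + v) := by
      refine fun l q => ⟨fun h => ⟨_, h⟩, ?_⟩
      rintro ⟨v, rfl⟩
      cases q <;> simp
    rw [sameShape_iff]
    refine exists_congr fun g => ?_
    rw [key, key, ← exists_or]
    refine exists_congr fun v => ?_
    simp only [List.map_map, List.map_reverse]
    rfl

/-! ### Points of a path -/

theorem pointsFrom_add (p q : ℤ × ℤ) (s : List Base) :
    pointsFrom (p + q) s = (pointsFrom p s).map (· + q) := by
  induction s generalizing p with
  | nil => rfl
  | cons b s ih =>
    simp only [pointsFrom, List.map_cons, ← ih]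
    rw [add_right_comm]

theorem length_pointsFrom (p : ℤ × ℤ) (s : List Base) : (pointsFrom p s).length = s.length := by
  induction s generalizing p with
  | nil => rfl
  | cons b s ih => simp [pointsFrom, ih]

theorem pointsFrom_append (p : ℤ × ℤ) (s t : List Base) :
    pointsFrom p (s ++ t) = pointsFrom p s ++ pointsFrom (p + (s.map Base.step).sum) t := by
  induction s generalizing p with
  | nil => simp [pointsFrom]
  | cons b s ih => simp [pointsFrom, ih, add_assoc]

/-- The path of a final segment is a translate of the corresponding part of the whole path. -/
theorem path_append (s t : List Base) :
    ∃ q, path (s ++ t) = path s ++ (path t).map (· + q) := by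
  refine ⟨(s.map Base.step).sum, ?_⟩
  rw [path, pointsFrom_append, pointsFrom_add]
  rfl

/-- If two sequences have the same shape, then an initial segment of the first one has the shape of
the initial or, because of reversal, of the final segment of the same length of the second one. -/
theorem SameShape.initial {s₁ s₂ t₁ t₂ t₃ t₄ : List Base}
    (h : SameShape (s₁ ++ s₂) (t₁ ++ t₂)) (ht : t₁ ++ t₂ = t₃ ++ t₄)
    (h₁ : s₁.length = t₁.length) (h₄ : s₁.length = t₄.length) :
    SameShape s₁ t₁ ∨ SameShape s₁ t₄ := by
  obtain ⟨g, v, h | h⟩ := sameShape_iff.1 h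
  · left
    obtain ⟨q, hq⟩ := path_append s₁ s₂
    obtain ⟨q', hq'⟩ := path_append t₁ t₂
    rw [hq, hq', List.map_append] at h
    have := List.append_inj_left h (by simp [path, length_pointsFrom, h₁])
    exact sameShape_iff.2 ⟨g, v, Or.inl this⟩
  · right
    obtain ⟨q, hq⟩ := path_append s₁ s₂
    obtain ⟨q', hq'⟩ := path_append t₃ t₄
    rw [hq, ht, hq', List.map_append, List.reverse_append] at h
    have := List.append_inj_left h (by simp [path, length_pointsFrom, h₄])
    refine sameShape_iff.2 ⟨g, act g q' + v, Or.inr ?_⟩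
    rw [this, List.map_map]
    congr 2
    funext p
    simp [act_add, add_assoc]

/-- Sameness of shape composes with a symmetry that does without reversal and translation. -/
theorem SameShape.trans_act {s t u : List Base} (h : SameShape s t) {k : ZMod 4 × Bool}
    (hk : path t = (path u).map (act k)) : SameShape s u := by
  obtain ⟨g, v, h⟩ := sameShape_iff.1 h
  refine sameShape_iff.2 ⟨comp g k, v, ?_⟩
  rw [hk, List.map_map] at h
  simpa only [Function.comp_def, ← act_comp] using h

/-- The lattice walk from `p` with the given steps. -/
def walk (p : ℤ × ℤ) : List (ℤ × ℤ) → List (ℤ × ℤ)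
  | [] => [p]
  | v :: l => p :: walk (p + v) l

theorem walk_act (g : ZMod 4 × Bool) (p : ℤ × ℤ) (l : List (ℤ × ℤ)) :
    walk (act g p) (l.map (act g)) = (walk p l).map (act g) := by
  induction l generalizing p with
  | nil => rfl
  | cons v l ih => simp [walk, ← ih, act_add]

theorem pointsFrom_eq_walk {s : List Base} {l : List (ℤ × ℤ)} {x : ℤ × ℤ}
    (h : s.map Base.step = l ++ [x]) (p : ℤ × ℤ) : pointsFrom p s = walk p l := by
  induction l generalizing p s with
  | nil =>
    obtain ⟨b, rfl, -⟩ := List.map_eq_singleton_iff.1 h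
    rfl
  | cons v l ih =>
    cases s with
    | nil => simp at h
    | cons b s =>
      simp only [List.map_cons, List.cons_append, List.cons.injEq] at h
      simp [pointsFrom, walk, ih h.2, h.1]

/-! ### Expansion as a substitution -/

/-- The code `c` transported along a rotation by `r`: quarter turns exchange the codes. -/
def spin (c : Code) (r : ZMod 4) : Code := if r = 0 ∨ r = 2 then c else c.compl

/-- The expansion of `b` in a sequence in which unrotated bases have code `c`. -/
def subst (c : Code) (b : Base) : List Base := b.expand (spin c b.rot)

theorem spin_spin (c : Code) (r : ZMod 4) : spin (spin c r) r = c := by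
  revert r; cases c <;> decide

theorem nextCode_spin (c : Code) (b b' : Base) :
    spin (nextCode c b b') b'.rot = spin c b.rot := by
  have : ∀ r r' : ZMod 4, spin (spin c (r - r')) r' = spin c r := by cases c <;> decide
  exact this b.rot b'.rot

/-- The code of each base depends only on the parity of its rotation, so that the expansion of a
sequence is a letterwise substitution. -/
theorem expandSeq_cons (c : Code) (b : Base) (s : List Base) :
    expandSeq c (b :: s) = (b :: s).flatMap (subst (spin c b.rot)) := by
  induction s generalizing c b with
  | nil => simp [expandSeq, subst, spin_spin]
  | cons b' s ih =>
    rw [expandSeq, ih, nextCode_spin, List.flatMap_cons (x := b)]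
    simp [subst, spin_spin]

/-- The `n`-fold substitution of `b`: the curve grown from `b` in `n` expansions, all of which use
the same substitution `subst c`. -/
def gen (c : Code) : ℕ → Base → List Base
  | 0, b => [b]
  | n + 1, b => (subst c b).flatMap (gen c n)

theorem gen_add (c : Code) (m n : ℕ) (b : Base) :
    gen c (m + n) b = (gen c m b).flatMap (gen c n) := by
  induction m generalizing b with
  | zero => simp [gen]
  | succ m ih =>
    rw [Nat.succ_add, gen, gen, List.flatMap_assoc]
    exact List.flatMap_congr fun z _ => ih z

theorem gen_one (c : Code) (b : Base) : gen c 1 b = subst c b := by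
  simp [gen]

theorem gen_succ' (c : Code) (n : ℕ) (b : Base) :
    gen c (n + 1) b = (gen c n b).flatMap (subst c) := by
  rw [gen_add]
  exact List.flatMap_congr fun z _ => gen_one c z

theorem length_subst (c : Code) (b : Base) : (subst c b).length = 4 := by
  obtain ⟨X, r⟩ := b
  simp only [subst, Base.expand, List.length_map]
  generalize spin c r = d
  cases X <;> cases d <;> rfl

theorem length_flatMap_of_const {α β : Type*} {f : α → List β} {m : ℕ}
    (hf : ∀ a, (f a).length = m) (s : List α) : (s.flatMap f).length = s.length * m := by
  simp [List.length_flatMap, hf]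

theorem length_gen (c : Code) (n : ℕ) (b : Base) : (gen c n b).length = 4 ^ n := by
  induction n with
  | zero => rfl
  | succ n ih => rw [gen_succ', length_flatMap_of_const (length_subst c), ih, pow_succ]

theorem block_flatMap {α β : Type*} {f : α → List β} {m : ℕ} (hf : ∀ a, (f a).length = m)
    {s : List α} {j : ℕ} (hj : j < s.length) : block m j (s.flatMap f) = f s[j] := by
  induction s generalizing j with
  | nil => simp at hj
  | cons a s ih =>
    cases j with
    | zero => simp [block, ← hf a]
    | succ j =>
      have := ih (j := j) (by simpa using hj)
      rw [List.getElem_cons_succ, ← this, block, block, List.flatMap_cons, List.drop_append, hf,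
        List.drop_eq_nil_of_le (by rw [hf]; nlinarith), Nat.succ_mul]
      simp

/-! ### Open bases and the Hilbert word -/

/-- An open base has an entry and an exit direction: its pattern is `I`, `R`, `L` or `U`. -/
def Base.IsOpen (b : Base) : Prop :=
  b.pattern = .I ∨ b.pattern = .R ∨ b.pattern = .L ∨ b.pattern = .U

instance : DecidablePred Base.IsOpen := fun _ => inferInstanceAs (Decidable (_ ∨ _))

instance : Fintype BasePattern :=
  ⟨{.I, .R, .L, .U, .B, .D, .P, .Q, .C}, fun X => by cases X <;> decide⟩

instance : Fintype Code := ⟨{.one, .two}, fun c => by cases c <;> decide⟩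

instance : Fintype Base :=
  Fintype.ofEquiv (BasePattern × ZMod 4)
    ⟨fun x => ⟨x.1, x.2⟩, fun b => ⟨b.pattern, b.rot⟩, fun _ => rfl, fun _ => rfl⟩

theorem isOpen_of_mem_subst {c : Code} {b z : Base} (hz : z ∈ subst c b) : z.IsOpen := by
  have : ∀ (c : Code) (b : Base), ∀ z ∈ subst c b, z.IsOpen := by decide +kernel
  exact this c b z hz

theorem isOpen_of_mem_gen {c : Code} {n : ℕ} {b z : Base} (hb : b.IsOpen)
    (hz : z ∈ gen c n b) : z.IsOpen := by
  cases n with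
  | zero =>
    rw [gen, List.mem_singleton] at hz
    exact hz ▸ hb
  | succ n =>
    rw [gen_succ', List.mem_flatMap] at hz
    obtain ⟨y, -, hz⟩ := hz
    exact isOpen_of_mem_subst hz

/-- The steps of the classical Hilbert curve of level `n` that starts in the lower left corner and
ends in the upper left one: four copies of the previous level, joined by steps to the right,
upwards and to the left, where the first and the last copy are reflected in a diagonal. -/
def hilbertWord : ℕ → List (ℤ × ℤ)
  | 0 => []
  | n + 1 => (hilbertWord n).map (act (3, true)) ++ [(1, 0)] ++ (hilbertWord n ++ [(0, 1)]) ++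
      (hilbertWord n ++ [(-1, 0)]) ++ (hilbertWord n).map (act (1, true))

/-- The symmetry that maps `hilbertWord` to the steps of the curves grown from the open base `b`
when unrotated bases have code `c`. (The value for bases that are not open is irrelevant.) -/
def frame (c : Code) (b : Base) : ZMod 4 × Bool :=
  match spin c b.rot, b.pattern with
  | .one, .R | .one, .U => (b.rot + 3, true)
  | .one, _ => (b.rot, false)
  | .two, .I | .two, .R => (b.rot, true)
  | .two, _ => (b.rot + 1, false)

/-- All curves that are grown from open bases with a constant substitution are, up to a symmetry
of the grid, Hilbert curves. -/
theorem map_step_gen (c : Code) (n : ℕ) {b : Base} (hb : b.IsOpen) :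
    (gen c n b).map Base.step = (hilbertWord n).map (act (frame c b)) ++ [b.step] := by
  induction n generalizing b with
  | zero => rfl
  | succ n ih =>
    have hlen := length_subst c b
    obtain ⟨b₁, b₂, b₃, b₄, hs⟩ : ∃ b₁ b₂ b₃ b₄, subst c b = [b₁, b₂, b₃, b₄] := by
      match subst c b, hlen with
      | [b₁, b₂, b₃, b₄], _ => exact ⟨b₁, b₂, b₃, b₄, rfl⟩
    -- The four bases of the unit are placed relative to `b` like the four copies in the Hilbert
    -- word, the symmetries `(3, true)` and `(1, true)` being the two diagonal reflections.
    have hf : ∀ (c : Code) (b : Base), b.IsOpen → (subst c b).map (frame c) =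
        [(3, true), (0, false), (0, false), (1, true)].map (comp (frame c b)) := by
      decide +kernel
    have hstep : ∀ (c : Code) (b : Base), b.IsOpen → (subst c b).map Base.step =
        [(1, 0), (0, 1), (-1, 0)].map (act (frame c b)) ++ [b.step] := by
      decide +kernel
    have hid : comp (frame c b) (0, false) = frame c b := by
      generalize frame c b = g
      revert g; decide
    have hopen : ∀ z ∈ subst c b, z.IsOpen := fun z => isOpen_of_mem_subst
    specialize hf c b hb
    specialize hstep c b hb
    rw [hs] at hf hstep hopen
    simp only [List.map_cons, List.map_nil, List.cons.injEq, List.cons_append, List.nil_append,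
      and_true, hid] at hf hstep
    have e : ∀ h : ZMod 4 × Bool, ∀ l : List (ℤ × ℤ),
        l.map (act (comp (frame c b) h)) = (l.map (act h)).map (act (frame c b)) := fun h l => by
      rw [List.map_map]
      exact List.map_congr_left fun p _ => act_comp _ _ p
    simp only [gen, hs, List.flatMap_cons, List.flatMap_nil, List.map_append, List.append_nil]
    rw [ih (hopen b₁ (by simp)), ih (hopen b₂ (by simp)), ih (hopen b₃ (by simp)),
      ih (hopen b₄ (by simp)), hf.1, hf.2.1, hf.2.2.1, hf.2.2.2, hstep.1, hstep.2.1, hstep.2.2.1,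
      hstep.2.2.2, e, e]
    simp [hilbertWord]

theorem path_gen (c : Code) (n : ℕ) {b : Base} (hb : b.IsOpen) :
    path (gen c n b) = (walk 0 (hilbertWord n)).map (act (frame c b)) := by
  rw [path, pointsFrom_eq_walk (map_step_gen c n hb), ← walk_act, act_zero]

theorem path_gen_eq (c c' : Code) (n : ℕ) {b b' : Base} (hb : b.IsOpen) (hb' : b'.IsOpen) :
    ∃ k, path (gen c n b) = (path (gen c' n b')).map (act k) := by
  refine ⟨comp (frame c b) (inv (frame c' b')), ?_⟩
  rw [path_gen c n hb, path_gen c' n hb', List.map_map]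
  refine List.map_congr_left fun p _ => ?_
  rw [Function.comp_apply, ← act_comp, comp_inv_cancel]

theorem sameShape_gen (c c' : Code) (n : ℕ) {b b' : Base} (hb : b.IsOpen) (hb' : b'.IsOpen) :
    SameShape (gen c n b) (gen c' n b') := by
  obtain ⟨k, hk⟩ := path_gen_eq c c' n hb hb'
  exact sameShape_iff.2 ⟨k, 0, Or.inl (by simpa using hk)⟩

/-! ### Curves grown from open bases -/

/-- Substitution preserves the rotation of the first base of an open base, so that a constant code
sequence keeps selecting the same substitution. -/
theorem gen_eq_cons (c : Code) (n : ℕ) {b : Base} (hb : b.IsOpen) :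
    ∃ z s, gen c n b = z :: s ∧ z.IsOpen ∧ z.rot = b.rot := by
  induction n generalizing b with
  | zero => exact ⟨b, [], rfl, hb, rfl⟩
  | succ n ih =>
    have hrot : ∀ (c : Code) (b : Base), b.IsOpen →
        (subst c b).head?.map Base.rot = some b.rot := by decide +kernel
    specialize hrot c b hb
    obtain ⟨y, hy, hyb⟩ := Option.map_eq_some_iff.1 hrot
    obtain ⟨t, ht⟩ := List.head?_eq_some_iff.1 hy
    obtain ⟨z, s, hz, hzo, hzy⟩ := ih (b := y)
      (isOpen_of_mem_subst (c := c) (b := b) (by simp [ht]))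
    exact ⟨z, s ++ t.flatMap (gen c n), by simp [gen, ht, hz], hzo, hzy.trans hyb⟩

theorem seq_append_singleton (b : Base) (l : List Code) (c : Code) :
    Curve.seq ⟨b, l ++ [c]⟩ = expandSeq c (Curve.seq ⟨b, l⟩) := by
  simp [Curve.seq]

theorem expandSeq_gen (c c' : Code) (n : ℕ) {b : Base} (hb : b.IsOpen) :
    expandSeq c' (gen c n b) = (gen c n b).flatMap (subst (spin c' b.rot)) := by
  obtain ⟨z, s, hz, -, hrot⟩ := gen_eq_cons c n hb
  rw [hz, expandSeq_cons, hrot]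

theorem seq_replicate (c : Code) (n : ℕ) {b : Base} (hb : b.IsOpen) :
    Curve.seq ⟨b, List.replicate n c⟩ = gen (spin c b.rot) n b := by
  induction n with
  | zero => rfl
  | succ n ih =>
    rw [List.replicate_succ', seq_append_singleton, ih, expandSeq_gen _ _ _ hb, gen_succ']

theorem spin_injective {c c' : Code} {r : ZMod 4} (h : spin c r = spin c' r) : c = c' := by
  rw [← spin_spin c r, h, spin_spin]

theorem hilbertUnit_eq_gen :
    Curve.seq ⟨⟨.I, 0⟩, [.one, .one]⟩ = gen .one 2 ⟨.I, 0⟩ :=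
  seq_replicate .one 2 (Or.inl rfl)

theorem isHilbertUnit_gen (c : Code) {b : Base} (hb : b.IsOpen) : IsHilbertUnit (gen c 2 b) := by
  rw [IsHilbertUnit, hilbertUnit_eq_gen]
  exact sameShape_gen _ _ _ hb (Or.inl rfl)

instance : DecidablePred IsHilbertUnit := fun _ => inferInstanceAs (Decidable (SameShape _ _))

/-! ### Curves of levels two to four -/

/-- Two different substitutions in succession never turn an open base into a Hilbert unit. -/
theorem eq_of_isHilbertUnit : ∀ (c c' : Code) (b : Base), b.IsOpen →
    IsHilbertUnit ((subst c b).flatMap (subst c')) → c = c' := by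
  decide +kernel

theorem isOpen_of_isHilbertUnit : ∀ (b : Base) (c c' : Code),
    IsHilbertUnit (Curve.seq ⟨b, [c, c']⟩) → b.IsOpen ∧ c = c' := by
  decide +kernel

/-- The level-3 condition for recursiveness: it holds for open seeds with a constant code and for
the exceptional curves only. -/
theorem recursive_levelThree : ∀ (b : Base) (c₁ c₂ c₃ : Code),
    (∀ j : Fin 4, SameShape (block 16 j (Curve.seq ⟨b, [c₁, c₂, c₃]⟩))
      (Curve.seq ⟨b, [c₁, c₂]⟩)) ↔
    (b.IsOpen ∧ c₂ = c₁ ∧ c₃ = c₁) ∨ ((b.pattern = .B ∨ b.pattern = .P) ∧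
      ([c₁, c₂, c₃] = [.one, .two, .one] ∨ [c₁, c₂, c₃] = [.two, .one, .two])) := by
  decide +kernel

/-- The exceptional curves have no recursive expansion, as the first subunit already fails. -/
theorem not_recursive_levelFour : ∀ (b : Base) (c₁ c₂ c₃ c₄ : Code),
    ((b.pattern = .B ∨ b.pattern = .P) ∧
      ([c₁, c₂, c₃] = [.one, .two, .one] ∨ [c₁, c₂, c₃] = [.two, .one, .two])) →
    ¬ SameShape (block 64 0 (Curve.seq ⟨b, [c₁, c₂, c₃, c₄]⟩))
      (Curve.seq ⟨b, [c₁, c₂, c₃]⟩) := by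
  decide +kernel

/-! ### Hilbert curves have an open seed and a constant code -/

theorem reduce_eq (P : Curve) {i : ℕ} (hi : i ≤ P.level) :
    P.reduce (P.level - i) = ⟨P.seed, P.code.take i⟩ := by
  rw [Curve.reduce, Nat.sub_sub_self hi]

theorem level_take (P : Curve) {i : ℕ} (hi : i ≤ P.level) :
    Curve.level ⟨P.seed, P.code.take i⟩ = i :=
  List.length_take_of_le hi

/-- The Hilbert property with the reductions replaced by prefixes of the code. -/
theorem isHilbert_iff (P : Curve) : P.IsHilbert ↔ 2 ≤ P.level ∧ ∀ i, 2 ≤ i → i ≤ P.level →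
    ∀ j < 4 ^ (i - 2), IsHilbertUnit (block 16 j (Curve.seq ⟨P.seed, P.code.take i⟩)) := by
  refine and_congr_right fun _ => forall₃_congr fun i _ hi => ?_
  rw [reduce_eq P hi]
  simp only [Curve.levelTwoUnit, Fin.forall_iff, level_take P hi]

/-- Recursiveness with the nested reductions replaced by prefixes of the code. -/
theorem isRecursive_iff (P : Curve) : P.IsRecursive ↔ ∀ i, 3 ≤ i → i ≤ P.level → ∀ j : Fin 4,
    SameShape (block (4 ^ (i - 1)) j (Curve.seq ⟨P.seed, P.code.take i⟩))
      (Curve.seq ⟨P.seed, P.code.take (i - 1)⟩) := by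
  refine forall₃_congr fun i _ hi => ?_
  rw [reduce_eq P hi]
  simp only [Curve.subunit, Curve.reduce, level_take P hi, List.take_take,
    min_eq_left (Nat.sub_le i 1)]

theorem isHilbert_replicate {b : Base} (hb : b.IsOpen) (c : Code) {k : ℕ} (hk : 2 ≤ k) :
    Curve.IsHilbert ⟨b, List.replicate k c⟩ := by
  refine (isHilbert_iff _).2 ⟨by simpa [Curve.level] using hk, fun i hi hik j hj => ?_⟩
  obtain ⟨m, rfl⟩ := Nat.exists_eq_add_of_le' hi
  have hik : m + 2 ≤ k := by simpa [Curve.level] using hik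
  have hj : j < (gen (spin c b.rot) m b).length := by simpa [length_gen] using hj
  simp only [List.take_replicate, min_eq_left hik, seq_replicate c _ hb, gen_add]
  rw [block_flatMap (m := 16) (length_gen _ 2) hj]
  exact isHilbertUnit_gen _ (isOpen_of_mem_gen hb (List.getElem_mem hj))

theorem isRecursive_replicate {b : Base} (hb : b.IsOpen) (c : Code) (k : ℕ) :
    Curve.IsRecursive ⟨b, List.replicate k c⟩ := by
  refine (isRecursive_iff _).2 fun i hi hik j => ?_
  obtain ⟨m, rfl⟩ := Nat.exists_eq_add_of_le' (Nat.one_le_of_lt hi)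
  have hik : m + 1 ≤ k := by simpa [Curve.level] using hik
  have hj : (j : ℕ) < (subst (spin c b.rot) b).length := by simp [length_subst]
  simp only [List.take_replicate, min_eq_left hik, Nat.add_sub_cancel, seq_replicate c _ hb,
    min_eq_left (Nat.le_of_succ_le hik)]
  rw [gen, block_flatMap (length_gen _ m) hj]
  exact sameShape_gen _ _ _ (isOpen_of_mem_subst (List.getElem_mem hj)) hb

/-- The first level-2 unit after a last substitution by `c'`. -/
theorem exists_gen_flatMap_eq_append (c c' : Code) (n : ℕ) {b : Base} (hb : b.IsOpen) :
    ∃ z t, (gen c (n + 1) b).flatMap (subst c') = (subst c z).flatMap (subst c') ++ t ∧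
      z.IsOpen := by
  obtain ⟨z, s, hz, hzo, -⟩ := gen_eq_cons c n hb
  refine ⟨z, (s.flatMap (subst c)).flatMap (subst c'), ?_, hzo⟩
  rw [gen_succ', hz, List.flatMap_cons, List.flatMap_append]

theorem length_subst_subst (c c' : Code) (b : Base) :
    ((subst c b).flatMap (subst c')).length = 16 := by
  rw [length_flatMap_of_const (length_subst c'), length_subst]

/-- A change of the substitution in the last expansion breaks the recursive structure: the
first level-2 unit of the first curve overlaps with the first or the last level-2 unit of the second
one, which are Hilbert units. -/
theorem eq_of_sameShape {c c' : Code} {m n : ℕ} {b b' : Base} (hb : b.IsOpen) (hb' : b'.IsOpen)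
    (h : SameShape ((gen c (m + 1) b').flatMap (subst c')) (gen c (n + 2) b)) : c = c' := by
  obtain ⟨z, s₂, hs, hz⟩ := exists_gen_flatMap_eq_append c c' m hb'
  have hne : gen c n b ≠ [] := List.ne_nil_of_length_pos (by simp [length_gen])
  obtain ⟨y, t, hy⟩ := List.exists_cons_of_ne_nil hne
  obtain ⟨t', y', hy'⟩ := List.eq_nil_or_concat' (gen c n b) |>.resolve_left hne
  have h₁ : gen c (n + 2) b = gen c 2 y ++ t.flatMap (gen c 2) := by
    rw [gen_add, hy, List.flatMap_cons]
  have h₂ : gen c (n + 2) b = t'.flatMap (gen c 2) ++ gen c 2 y' := by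
    rw [gen_add, hy', List.flatMap_append, List.flatMap_singleton]
  have hyo : y.IsOpen := isOpen_of_mem_gen hb (by rw [hy]; simp)
  have hyo' : y'.IsOpen := isOpen_of_mem_gen hb (by rw [hy']; simp)
  refine eq_of_isHilbertUnit c c' z hz ?_
  rw [IsHilbertUnit, hilbertUnit_eq_gen]
  rw [hs, h₁] at h
  rcases h.initial (h₁.symm.trans h₂) (by rw [length_subst_subst, length_gen]; rfl)
    (by rw [length_subst_subst, length_gen]; rfl) with h | h
  · obtain ⟨k, hk⟩ := path_gen_eq c .one 2 hyo (b' := ⟨.I, 0⟩) (Or.inl rfl)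
    exact h.trans_act hk
  · obtain ⟨k, hk⟩ := path_gen_eq c .one 2 hyo' (b' := ⟨.I, 0⟩) (Or.inl rfl)
    exact h.trans_act hk

/-- A list is constant if its prefix of length `i₀` is and no first deviation can occur later. -/
theorem eq_replicate_of_step {α : Type*} {l : List α} {a : α} {i₀ : ℕ}
    (h₀ : l.take i₀ = List.replicate i₀ a) (hi₀ : i₀ ≤ l.length)
    (step : ∀ i, i₀ ≤ i → i < l.length → ∀ x,
      l.take i = List.replicate i a → l.take (i + 1) = List.replicate i a ++ [x] → a = x) :
    l = List.replicate l.length a := by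
  have : ∀ i, i₀ ≤ i → i ≤ l.length → l.take i = List.replicate i a := by
    intro i hi
    induction i, hi using Nat.le_induction with
    | base => exact fun _ => h₀
    | succ i hi ih =>
      intro hil
      have hx := List.take_concat_get' l i hil
      rw [ih (Nat.le_of_succ_le hil)] at hx
      rw [← hx, List.replicate_succ', ← step i hi hil _ (ih (Nat.le_of_succ_le hil)) hx.symm]
  simpa using this l.length hi₀ le_rfl

theorem isHilbert_iff_replicate (P : Curve) : P.IsHilbert ↔
    P.seed.IsOpen ∧ 2 ≤ P.level ∧ ∃ c, P.code = List.replicate P.level c := by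
  constructor
  · obtain ⟨b, l⟩ := P
    intro h
    obtain ⟨hl, h⟩ := (isHilbert_iff _).1 h
    obtain ⟨c, c', r, rfl⟩ : ∃ c c' r, l = c :: c' :: r := by
      match l, hl with
      | c :: c' :: r, _ => exact ⟨c, c', r, rfl⟩
    have h2 : IsHilbertUnit (Curve.seq ⟨b, [c, c']⟩) := by
      have h2 := h 2 le_rfl hl 0 (by simp)
      have hlen : (Curve.seq ⟨b, [c, c']⟩).length = 16 := by
        have : ∀ b c c', (Curve.seq ⟨b, [c, c']⟩).length = 16 := by decide +kernel
        exact this b c c'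
      simpa [block, ← hlen] using h2
    obtain ⟨hb, rfl⟩ := isOpen_of_isHilbertUnit b c c' h2
    refine ⟨hb, hl, c, eq_replicate_of_step (i₀ := 2) (by simp [List.replicate]) hl ?_⟩
    intro i hi hil x _ hx
    obtain ⟨m, rfl⟩ := Nat.exists_eq_add_of_le' (Nat.one_le_of_lt hi)
    have hu := h (m + 2) (by omega) hil 0 (by positivity)
    rw [hx, seq_append_singleton, seq_replicate c _ hb, expandSeq_gen _ _ _ hb] at hu
    obtain ⟨z, t, hz, hzo⟩ :=
      exists_gen_flatMap_eq_append (spin c b.rot) (spin x b.rot) m hb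
    rw [hz, block, Nat.zero_mul, List.drop_zero,
      List.take_left' (length_subst_subst _ _ _)] at hu
    exact spin_injective (eq_of_isHilbertUnit _ _ z hzo hu)
  · rintro ⟨hb, hl, c, hc⟩
    obtain ⟨b, l⟩ := P
    rw [show l = List.replicate _ c from hc]
    exact isHilbert_replicate hb c hl

/-! ### Recursive curves -/

theorem Curve.IsHilbert.isRecursive {P : Curve} (h : P.IsHilbert) : P.IsRecursive := by
  obtain ⟨hb, -, c, hc⟩ := (isHilbert_iff_replicate P).1 h
  obtain ⟨b, l⟩ := P
  rw [show l = List.replicate _ c from hc]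
  exact isRecursive_replicate hb c _

/-- A recursive curve whose first three codes agree never changes its code. -/
theorem Curve.IsRecursive.eq_replicate {b : Base} {l : List Code}
    (h : Curve.IsRecursive ⟨b, l⟩) (hb : b.IsOpen) {c : Code} (hl : 3 ≤ l.length)
    (h₃ : l.take 3 = List.replicate 3 c) : l = List.replicate l.length c := by
  refine eq_replicate_of_step h₃ hl fun i hi hil x hc hx => ?_
  have hr := (isRecursive_iff _).1 h (i + 1) (by omega) hil 0
  obtain ⟨m, rfl⟩ := Nat.exists_eq_add_of_le' (Nat.le_of_succ_le hi)
  simp only [Nat.add_sub_cancel, hc] at hr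
  rw [hx, seq_append_singleton, seq_replicate c _ hb, expandSeq_gen _ _ _ hb, gen,
    List.flatMap_assoc, block_flatMap (m := 4 ^ (m + 2))
      (fun a => by rw [length_flatMap_of_const (length_subst _), length_gen, ← pow_succ])
      (by simp [length_subst])] at hr
  exact spin_injective
    (eq_of_sameShape (n := m) hb (isOpen_of_mem_subst (List.getElem_mem _)) hr)

end TwoByTwo

theorem mainTheorem12 :
    (∀ P : TwoByTwo.Curve, P.IsHilbert → P.IsRecursive) ∧
    (∀ P : TwoByTwo.Curve, 3 ≤ P.level →
      (P.IsRecursive ↔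
        P.IsHilbert ∨
          ((P.seed.pattern = TwoByTwo.BasePattern.B ∨
              P.seed.pattern = TwoByTwo.BasePattern.P) ∧
            (P.code = [TwoByTwo.Code.one, TwoByTwo.Code.two, TwoByTwo.Code.one] ∨
              P.code = [TwoByTwo.Code.two, TwoByTwo.Code.one, TwoByTwo.Code.two])))) := by
  open TwoByTwo in
  refine ⟨fun P h => h.isRecursive, fun P hl => ⟨fun h => ?_, ?_⟩⟩
  · obtain ⟨b, l⟩ := P
    obtain ⟨c₁, c₂, c₃, r, rfl⟩ : ∃ c₁ c₂ c₃ r, l = c₁ :: c₂ :: c₃ :: r := by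
      match l, hl with
      | c₁ :: c₂ :: c₃ :: r, _ => exact ⟨c₁, c₂, c₃, r, rfl⟩
    have hr := (isRecursive_iff _).1 h
    rcases (recursive_levelThree b c₁ c₂ c₃).1 (hr 3 le_rfl hl) with ⟨hb, rfl, rfl⟩ | hexc
    · exact Or.inl ((isHilbert_iff_replicate _).2
        ⟨hb, Nat.le_of_succ_le hl, c₃, h.eq_replicate hb hl rfl⟩)
    · cases r with
      | nil => exact Or.inr hexc
      | cons c₄ r =>
        exact absurd (hr 4 (by norm_num) (by simp [Curve.level]) 0)
          (not_recursive_levelFour b c₁ c₂ c₃ c₄ hexc)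
  · rintro (h | h)
    · exact h.isRecursive
    · obtain ⟨b, l⟩ := P
      obtain ⟨c₁, c₂, c₃, rfl⟩ : ∃ c₁ c₂ c₃, l = [c₁, c₂, c₃] := by
        rcases h.2 with h | h <;> exact ⟨_, _, _, h⟩
      refine (isRecursive_iff _).2 fun i hi hik => ?_
      obtain rfl : i = 3 := le_antisymm hik hi
      exact (recursive_levelThree b c₁ c₂ c₃).2 (Or.inr h)
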